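/- **Notation.** For $n\ge 1$ and $d\ge 0$ let $Q,K,V\in\mathbb R^{n\times d}$. Let $M\in\{0,1\}^{n\times n}$ be the causal mask, $M_{i,j}=1$ iff $i\ge j$. Put $A=M\circ\exp(QK^\top)$ (entrywise product and exponential), $D=\mathrm{diag}(A\mathbf 1_n)$, $Y=D^{-1}AV$, $\widetilde H=M\circ(QK^\top)$, and write $\widetilde H_j$ for the $j$-th column of $\widetilde H$. Write $\|\cdot\|_\infty$ for the largest absolute value of an entry, $[n]=\{1,\dots,n\}$, and, for $b\in\mathbb R^n$, $m\in[n]$, let $\mathsf{conv}(b,m)\in\mathbb R^{n\times n}$ be the matrix whose lower right $m\times m$ block is the lower triangular Toeplitz matrix with first column $(b_1,\dots,b_m)^\top$ and whose other entries are $0$. **Algorithm 1**, with input $Q,K,V$ (and $M$) and hyper-parameters $k,T\in[n]$, $\delta,\epsilon\ge 0$: 1. Start with $v=\mathbf 0_T$, $u=\mathbf 0_n$, $s=0$, $t=n-T+1$. For $i=1,\dots,k$: replace $s$ by $s+1$, and then by $\textsc{Search}(v,s,t)$; set $m_i=n-s+1$; compute $\widetilde H_s=M_s\circ(Q(K^\top)_s)$;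 set $(b'_i)_p=(\widetilde H_s)_{s+p-1}-u_p$ for $p\le m_i$ and $(b'_i)_p=0$ for $p>m_i$; add $(b'_i)_{1:T}$ to $v$ and $b'_i$ to $u$. Here $\textsc{Search}(v,s,t)$ returns $s$ if $s\ge t$; otherwise it puts $j=\lfloor (s+t)/2\rfloor$, computes $\widetilde H_j$, and returns $\textsc{Search}(v,s,j)$ if $\|(\widetilde H_j)_{j:j+T-1}-v\|_1\ge\delta-2T\epsilon$, and $\textsc{Search}(v,j+1,t)$ otherwise. 2. Set $\widetilde b_1=\exp(b'_1)$ and $\widetilde b_r=\exp(\sum_{l\le r}b'_l)-\exp(\sum_{l\le r-1}b'_l)$ for $2\le r\le k$. 3. Compute $\widetilde D=\mathrm{diag}(\sum_{r\le k}\mathsf{conv}(\widetilde b_r,m_r)\mathbf 1_n)$ and output $\widetilde Y=\widetilde D^{-1}\sum_{r\le k}\mathsf{conv}(\widetilde b_r,m_r)V$. Each product of a matrix $\mathsf{conv}(\widetilde b_r,m_r)$ with $\mathbf 1_n$ or with a column of $V$ is computed by the radix-2 fast Fourier transform, after padding with zeros to a power of two. The algorithm runs in exact arithmetic on a real random access machine,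 where arithmetic operations, comparisons and elementary functions of numbers, index operations, and reads and writes of a cell have unit cost. A run that reads outside an array or divides by zero has no output. **Statement.** (i) For all $n\ge1$, $d\ge 0$, all $Q,K,V\in\mathbb R^{n\times d}$ and all $\epsilon\ge0$ there are $k,T\in[n]$ and $\delta\ge0$ such that Algorithm 1 with input $Q,K,V$ and hyper-parameters $k,T,\delta,\epsilon$ outputs a matrix $\widetilde Y$ with $$\|Y-\widetilde Y\|_\infty\le 2(\exp(2\epsilon)-1)\|V\|_\infty .$$ (ii) There is an absolute constant $C$ such that for every $n\ge1$ there are $k,T\in[n]$ and $\delta\ge0$ for which, for every $d\ge 0$ and all $Q,K,V\in\mathbb R^{n\times d}$, Algorithm 1 with hyper-parameters $k,T,\delta$ and $\epsilon=0$ outputs exactly $Y$, and, if $n\ge2$ and $d\ge1$, does so within $C\,n^2 d\log n$ steps. -/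

import Mathlib

open scoped Matrix

/-! On matrices, `‖A‖` denotes the largest absolute value of an entry. -/
attribute [local instance] Matrix.normedAddCommGroup

noncomputable section

namespace ConvAttn

/-! ### Exact masked attention -/

/-- The causal attention mask: `M i j = 1` if `i ≥ j`, and `0` otherwise. -/
def causalMask (n : ℕ) : Matrix (Fin n) (Fin n) ℝ :=
  Matrix.of fun i j => if j ≤ i then 1 else 0

/-- `A = M ∘ exp (Q Kᵀ)`, with `∘` and `exp` taken entry by entry. -/
def attnMatrix {n d : ℕ} (Q K : Matrix (Fin n) (Fin d) ℝ) : Matrix (Fin n) (Fin n) ℝ :=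
  Matrix.hadamard (causalMask n) ((Q * Kᵀ).map Real.exp)

/-- `Y = D⁻¹ A V`, where `D = diag (A 1)`. -/
def attention {n d : ℕ} (Q K V : Matrix (Fin n) (Fin d) ℝ) : Matrix (Fin n) (Fin d) ℝ :=
  (Matrix.diagonal (attnMatrix Q K *ᵥ fun _ => 1))⁻¹ * attnMatrix Q K * V

/-! ### The machine model

Algorithms are run on a random access machine over the real numbers. One step is one arithmetic
operation, comparison or elementary function evaluation on numbers, one arithmetic operation on
indices, one read or write of a memory cell, or one loop or branch instruction. A run may abort:
reading outside the bounds of an array and dividing by zero are errors. -/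

/-- The outcome of a run: its output (`none` if it aborted) and the number of steps taken. -/
structure Run (α : Type) where
  out : Option α
  time : ℕ

namespace Run

variable {α β : Type}

/-- Return `a`, which has been computed with `c` steps. -/
def charge (c : ℕ) (a : α) : Run α := ⟨some a, c⟩

/-- Return `a`, which has been computed with one step. -/
def step (a : α) : Run α := charge 1 a

/-- Spend `c` steps. -/
def tick (c : ℕ) : Run Unit := charge c ()

/-- Abort. -/
def fail : Run α := ⟨none, 1⟩

/-- Sequential composition: an error is final, and the steps add up. -/
protected def bind (x : Run α) (f : α → Run β) : Run β :=
  match x.out with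
  | none => ⟨none, x.time⟩
  | some a => ⟨(f a).out, x.time + (f a).time⟩

instance : Monad Run where
  pure a := ⟨some a, 0⟩
  bind := Run.bind

/-! Unit cost operations, used for numbers in `ℝ` and `ℂ` and for indices in `ℕ`. -/

def add [Add α] (x y : α) : Run α := step (x + y)

def sub [Sub α] (x y : α) : Run α := step (x - y)

def mul [Mul α] (x y : α) : Run α := step (x * y)

def div {F : Type} [Field F] [DecidableEq F] (x y : F) : Run F :=
  if y = 0 then fail else step (x / y)

def abs (x : ℝ) : Run ℝ := step |x|

def exp (x : ℝ) : Run ℝ := step (Real.exp x)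

def le (x y : ℝ) : Run Bool := step (decide (x ≤ y))

/-- Comparison of two indices. -/
def ltIdx (i j : ℕ) : Run Bool := step (decide (i < j))

/-- Read a cell of an array (cells are numbered from `0`). -/
def get {n : ℕ} (a : Fin n → α) (i : ℕ) : Run α :=
  if h : i < n then step (a ⟨i, h⟩) else fail

/-- Read an entry of a matrix (rows and columns are numbered from `0`). -/
def entry {n m : ℕ} (A : Matrix (Fin n) (Fin m) ℝ) (i j : ℕ) : Run ℝ :=
  if h : i < n ∧ j < m then step (A ⟨i, h.1⟩ ⟨j, h.2⟩) else fail

/-- The loop that fills the cells `i = 0, …, n - 1` of a new array with the values computed by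
`f i`. Each round costs two steps (loop control, write) in addition to the cost of `f i`. -/
def build : (n : ℕ) → (ℕ → Run α) → Run (Fin n → α)
  | 0, _ => step Fin.elim0
  | n + 1, f => do
    let a ← build n f
    let x ← f n
    tick 2
    pure (Fin.snoc (α := fun _ => α) a x)

/-- The loop that adds up the numbers computed by `f 0, …, f (n - 1)`. -/
def sumLoop : ℕ → (ℕ → Run ℝ) → Run ℝ
  | 0, _ => step 0
  | n + 1, f => do
    let a ← sumLoop n f
    let x ← f n
    tick 1
    add a x

/-- Entrywise sum of two arrays of length `n`. -/
def vecAdd {n : ℕ} (a b : Fin n → ℝ) : Run (Fin n → ℝ) :=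
  build n fun i => do
    let x ← get a i
    let y ← get b i
    add x y

/-- The loop that adds up the arrays computed by `f 0, …, f (r - 1)`. -/
def vecSumLoop {n : ℕ} : ℕ → (ℕ → Run (Fin n → ℝ)) → Run (Fin n → ℝ)
  | 0, _ => build n fun _ => step 0
  | r + 1, f => do
    let a ← vecSumLoop r f
    let x ← f r
    tick 1
    vecAdd a x

end Run

open Run

/-! ### Sub-convolution by fast Fourier transform -/

/-- The root of unity `exp (σ · 2πi · j / N)`. -/
def rootOfUnity (σ : ℝ) (j N : ℕ) : ℂ :=
  Complex.exp (((σ * (2 * Real.pi * j) / N : ℝ) : ℂ) * Complex.I)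

/-- The radix-2 fast Fourier transform: from `x` of length `N = 2 ^ L`, compute the array with
entries `∑ j, x j * exp (σ · 2πi · j * l / N)`. The forward transform has `σ = -1`, the inverse one
(before division by `N`) has `σ = 1`. -/
def fft (σ : ℝ) : (L : ℕ) → (Fin (2 ^ L) → ℂ) → Run (Fin (2 ^ L) → ℂ)
  | 0, x => step x
  | L + 1, x => do
    let e ← build (2 ^ L) fun j => do
      let p ← mul 2 j
      get x p
    let o ← build (2 ^ L) fun j => do
      let p ← mul 2 j
      let q ← add p 1
      get x q
    let E ← fft σ L e
    let O ← fft σ L o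
    let W ← build (2 ^ L) fun j => do
      let w ← charge 8 (rootOfUnity σ j (2 ^ (L + 1)))
      let z ← get O j
      mul w z
    build (2 ^ (L + 1)) fun l => do
      let low ← ltIdx l (2 ^ L)
      if low then do
        let a ← get E l
        let b ← get W l
        add a b
      else do
        let p ← sub l (2 ^ L)
        let a ← get E p
        let b ← get W p
        sub a b

/-- Computation of `conv(a, m) x`, where `conv(a, m)` is the `n × n` matrix whose lower right
`m × m` block is the lower triangular Toeplitz matrix with first column `a 0, …, a (m - 1)` and
whose other entries are `0`: multiply the transforms of `a 0, …, a (m - 1)` and of the last `m`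
entries of `x`, both padded with zeros to a length `2 ^ L ≥ 2 m` (found by `L` doublings), and
transform back. -/
def subConvMul {n : ℕ} (a : Fin n → ℝ) (m : ℕ) (x : Fin n → ℝ) : Run (Fin n → ℝ) := do
  let L ← charge (Nat.clog 2 (2 * m) + 2) (Nat.clog 2 (2 * m))
  let off ← sub n m
  let a₀ ← build (2 ^ L) fun p => do
    let inside ← ltIdx p m
    if inside then do
      let y ← get a p
      step (y : ℂ)
    else step (0 : ℂ)
  let x₀ ← build (2 ^ L) fun p => do
    let inside ← ltIdx p m
    if inside then do
      let q ← add off p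
      let y ← get x q
      step (y : ℂ)
    else step (0 : ℂ)
  let Fa ← fft (-1) L a₀
  let Fx ← fft (-1) L x₀
  let P ← build (2 ^ L) fun p => do
    let y ← get Fa p
    let z ← get Fx p
    mul y z
  let z ← fft 1 L P
  build n fun i => do
    let above ← ltIdx i off
    if above then step 0
    else do
      let p ← sub i off
      let y ← get z p
      let w ← div y ((2 ^ L : ℕ) : ℂ)
      step w.re

/-! ### The algorithm

Positions `s`, `t`, `j` are numbered from `1`, so that position `j` is cell `j - 1` of an array. -/

section

variable {n d : ℕ}

/-- Column `j` of `M ∘ (Q Kᵀ)`, computed as `M_j ∘ (Q (Kᵀ)_j)`. -/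
def column (Q K : Matrix (Fin n) (Fin d) ℝ) (j : ℕ) : Run (Fin n → ℝ) := do
  let c ← sub j 1
  build n fun i => do
    let q ← sumLoop d fun l => do
      let x ← entry Q i l
      let y ← entry K c l
      mul x y
    let μ ← entry (causalMask n) i c
    mul μ q

/-- The test of the binary search at position `j`:
is `‖(column j)_{j : j + T - 1} - v‖₁ ≥ δ - 2 T ε`? -/
def probe (Q K : Matrix (Fin n) (Fin d) ℝ) (T : ℕ) (δ ε : ℝ) (v : Fin T → ℝ) (j : ℕ) :
    Run Bool := do
  let h ← column Q K j
  let c ← sub j 1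
  let α ← sumLoop T fun p => do
    let q ← add c p
    let x ← get h q
    let y ← get v p
    let z ← sub x y
    abs z
  let two_T ← mul 2 (T : ℝ)
  let e ← mul two_T ε
  let threshold ← sub δ e
  le threshold α

/-- Binary search for the next basis position between `s` and `t`. -/
def search (Q K : Matrix (Fin n) (Fin d) ℝ) (T : ℕ) (δ ε : ℝ) (v : Fin T → ℝ) (s t : ℕ) :
    Run ℕ :=
  if h : t ≤ s then step s
  else do
    -- comparison of `s` and `t`, and two steps for the midpoint
    tick 3
    let found ← probe Q K T δ ε v ((s + t) / 2)
    if found then search Q K T δ ε v s ((s + t) / 2)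
    else do
      tick 1
      search Q K T δ ε v ((s + t) / 2 + 1) t
termination_by t - s

/-- The state after `i` rounds of the main loop: the running sums `v` and `u`, the current
position `s`, and the vectors `b'_1, …, b'_i` and sizes `m_1, …, m_i` found so far. -/
structure LoopState (n T i : ℕ) where
  v : Fin T → ℝ
  u : Fin n → ℝ
  s : ℕ
  b : Fin i → Fin n → ℝ
  m : Fin i → ℕ

/-- One round of the main loop. -/
def recoverRound {T i : ℕ} (Q K : Matrix (Fin n) (Fin d) ℝ) (δ ε : ℝ) (t : ℕ)
    (st : LoopState n T i) : Run (LoopState n T (i + 1)) := do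
  let s₀ ← add st.s 1
  let s ← search Q K T δ ε st.v s₀ t
  let n₁ ← add n 1
  let m ← sub n₁ s
  let h ← column Q K s
  let c ← sub s 1
  let b ← build n fun p => do
    let inside ← ltIdx p m
    if inside then do
      let q ← add c p
      let x ← get h q
      let y ← get st.u p
      sub x y
    else step 0
  let v ← build T fun p => do
    let x ← get st.v p
    let y ← get b p
    add x y
  let u ← vecAdd st.u b
  tick 2
  pure ⟨v, u, s, Fin.snoc (α := fun _ => Fin n → ℝ) st.b b, Fin.snoc (α := fun _ => ℕ) st.m m⟩

/-- The first `i` rounds of the main loop, preceded by the initialisation. -/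
def recoverLoop (Q K : Matrix (Fin n) (Fin d) ℝ) (T : ℕ) (δ ε : ℝ) (t : ℕ) :
    (i : ℕ) → Run (LoopState n T i)
  | 0 => do
    let v ← build T fun _ => step 0
    let u ← build n fun _ => step 0
    tick 1
    pure ⟨v, u, 0, Fin.elim0, Fin.elim0⟩
  | i + 1 => do
    let st ← recoverLoop Q K T δ ε t i
    tick 1
    recoverRound Q K δ ε t st

/-- From `b'_1, …, b'_k` compute `b̃_1 = exp b'_1` and
`b̃_r = exp (b'_1 + ⋯ + b'_r) - exp (b'_1 + ⋯ + b'_{r - 1})` for `r ≥ 2`. The result after `r` rounds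
is the partial sum `b'_1 + ⋯ + b'_r` together with `b̃_1, …, b̃_r`. -/
def expBasis {k : ℕ} (b : Fin k → Fin n → ℝ) : (r : ℕ) → Run ((Fin n → ℝ) × (Fin r → Fin n → ℝ))
  | 0 => do
    let z ← build n fun _ => step 0
    pure (z, Fin.elim0)
  | r + 1 => do
    let prev ← expBasis b r
    let br ← get b r
    let sum ← vecAdd prev.1 br
    let new ← build n fun l => do
      let x ← get sum l
      let ex ← exp x
      let later ← ltIdx 0 r
      if later then do
        let y ← get prev.1 l
        let ey ← exp y
        sub ex ey
      else pure ex
    tick 2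
    pure (sum, Fin.snoc (α := fun _ => Fin n → ℝ) prev.2 new)

/-- `Recover`: the vectors `b̃_1, …, b̃_k` and the sizes `m_1, …, m_k`. -/
def recover (Q K : Matrix (Fin n) (Fin d) ℝ) (k T : ℕ) (δ ε : ℝ) :
    Run ((Fin k → Fin n → ℝ) × (Fin k → ℕ)) := do
  let n₁ ← add n 1
  let t ← sub n₁ T
  let st ← recoverLoop Q K T δ ε t k
  let e ← expBasis st.b k
  pure (e.2, st.m)

/-- `∑ r, conv(b_r, m_r) x`, one fast sub-convolution for each `r`. -/
def basisMul {k : ℕ} (b : Fin k → Fin n → ℝ) (m : Fin k → ℕ) (x : Fin n → ℝ) :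
    Run (Fin n → ℝ) :=
  vecSumLoop k fun r => do
    let br ← get b r
    let mr ← get m r
    subConvMul br mr x

/-- The main algorithm: recover the basis, compute the diagonal of
`D̃ = diag (∑ r, conv(b̃_r, m_r) 1)`, compute `∑ r, conv(b̃_r, m_r) V` column by column, and return
`Ỹ = D̃⁻¹ ∑ r, conv(b̃_r, m_r) V`. -/
def convForward (Q K V : Matrix (Fin n) (Fin d) ℝ) (k T : ℕ) (δ ε : ℝ) :
    Run (Matrix (Fin n) (Fin d) ℝ) := do
  let basis ← recover Q K k T δ ε
  let one ← build n fun _ => step 1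
  let D ← basisMul basis.1 basis.2 one
  let Z ← build d fun c => do
    let x ← build n fun i => entry V i c
    basisMul basis.1 basis.2 x
  let Y ← build n fun i => do
    let w ← get D i
    build d fun c => do
      let col ← get Z c
      let y ← get col i
      div y w
  pure (Matrix.of Y)

end

end ConvAttn

end

/-! Both parts use the same choice: `k = n`, `T = 1`, `δ = 0`. The threshold `δ - 2Tε = -2ε` is then
at most `0`, so every probe succeeds (`computes_probe`), every search collapses to its left end
(`computes_search`), and the rounds find the positions `1, …, n` in order. The basis is full: one
block of each size `n, n - 1, …, 1`.

In each round the vector `u` is overwritten, on the range of the new block, by the current column of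
the masked logits read from its diagonal entry down. Hence the differences of exponentials
telescope, and the sub-convolution matrices sum to `A` itself, with no error
(`sum_subConv_expIncrements`). The output is exactly `Y` for every `ε ≥ 0`, and the bound in the
first part only needs its right side to be nonnegative.

For the time, there are `n` searches with `O(log n)` probes of cost `O(n d)`, and `(d + 1) n`
sub-convolutions of cost `O(n log n)` (`computes_fft`, `computes_subConvMul`).
`computes_convForward` adds these up. Output and step bound are carried together by `Computes`, so
each program is traversed only once. -/

noncomputable section

namespace ConvAttn

/-! ### A calculus of outputs and step bounds. -/

namespace Run

variable {α β : Type}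

/-- The run `x` succeeds with output `a` within `c` steps. -/
def Computes (x : Run α) (a : α) (c : ℕ) : Prop := x.out = some a ∧ x.time ≤ c

theorem Computes.mono {x : Run α} {a : α} {c c' : ℕ} (h : Computes x a c) (hc : c ≤ c') :
    Computes x a c' := ⟨h.1, h.2.trans hc⟩

theorem Computes.congr {x : Run α} {a a' : α} {c c' : ℕ} (h : Computes x a c) (ha : a = a')
    (hc : c ≤ c') : Computes x a' c' := ha ▸ h.mono hc

theorem Computes.bind {x : Run α} {f : α → Run β} {a : α} {b : β} {c c' : ℕ}
    (hx : Computes x a c) (hf : Computes (f a) b c') : Computes (x >>= f) b (c + c') := by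
  obtain ⟨xo, xt⟩ := x
  obtain ⟨h1, h2⟩ := hx
  obtain rfl : xo = some a := h1
  exact ⟨hf.1, Nat.add_le_add h2 hf.2⟩

theorem computes_pure (a : α) : Computes (pure a) a 0 := ⟨rfl, le_rfl⟩

theorem computes_charge (c : ℕ) (a : α) : Computes (charge c a) a c := ⟨rfl, le_rfl⟩

theorem computes_step (a : α) : Computes (step a) a 1 := ⟨rfl, le_rfl⟩

theorem computes_tick (c : ℕ) : Computes (tick c) () c := ⟨rfl, le_rfl⟩

theorem computes_add [Add α] (x y : α) : Computes (add x y) (x + y) 1 := ⟨rfl, le_rfl⟩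

theorem computes_sub [Sub α] (x y : α) : Computes (sub x y) (x - y) 1 := ⟨rfl, le_rfl⟩

theorem computes_mul [Mul α] (x y : α) : Computes (mul x y) (x * y) 1 := ⟨rfl, le_rfl⟩

theorem computes_div {F : Type} [Field F] [DecidableEq F] (x : F) {y : F} (hy : y ≠ 0) :
    Computes (div x y) (x / y) 1 := by
  simp only [div, if_neg hy]
  exact computes_step _

theorem computes_abs (x : ℝ) : Computes (abs x) |x| 1 := ⟨rfl, le_rfl⟩

theorem computes_exp (x : ℝ) : Computes (exp x) (Real.exp x) 1 := ⟨rfl, le_rfl⟩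

theorem computes_le (x y : ℝ) : Computes (le x y) (decide (x ≤ y)) 1 := ⟨rfl, le_rfl⟩

theorem computes_ltIdx (i j : ℕ) : Computes (ltIdx i j) (decide (i < j)) 1 := ⟨rfl, le_rfl⟩

theorem computes_get {n : ℕ} (a : Fin n → α) {i : ℕ} (h : i < n) :
    Computes (get a i) (a ⟨i, h⟩) 1 := by
  simp only [get, dif_pos h]
  exact computes_step _

theorem computes_entry {n m : ℕ} (A : Matrix (Fin n) (Fin m) ℝ) {i j : ℕ} (hi : i < n)
    (hj : j < m) : Computes (entry A i j) (A ⟨i, hi⟩ ⟨j, hj⟩) 1 := by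
  simp only [entry, dif_pos (show i < n ∧ j < m from ⟨hi, hj⟩)]
  exact computes_step _

theorem Computes.ite {p : Prop} [Decidable p] {x y : Run α} {a : α} {c : ℕ}
    (hx : p → Computes x a c) (hy : ¬p → Computes y a c) :
    Computes (if p then x else y) a c := by
  split_ifs with h
  exacts [hx h, hy h]

/-- Comparing two indices and branching on the outcome. -/
theorem Computes.branch {i j : ℕ} {x y : Run α} {a : α} {c : ℕ}
    (hx : i < j → Computes x a c) (hy : ¬i < j → Computes y a c) :
    Computes (ltIdx i j >>= fun b => if b = true then x else y) a (1 + c) :=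
  (computes_ltIdx i j).bind
    (Computes.ite (fun h => hx (of_decide_eq_true h)) fun h => hy fun h' => h (decide_eq_true h'))

theorem computes_build {n : ℕ} {f : ℕ → Run α} {g : Fin n → α} {c : ℕ}
    (h : ∀ i : Fin n, Computes (f i) (g i) c) : Computes (build n f) g (n * (c + 2) + 1) := by
  induction n with
  | zero =>
    rw [Subsingleton.elim g Fin.elim0]
    exact (computes_step _).mono (by simp)
  | succ n ih =>
    have hlast := h (Fin.last n)
    apply Computes.congr
    · apply (ih (g := fun i => g i.castSucc) fun i => h i.castSucc).bind
      apply hlast.bind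
      apply (computes_tick 2).bind
      exact computes_pure _
    · exact Fin.snoc_init_self (α := fun _ => α) g
    · linarith

theorem Computes.build_bind {n : ℕ} {f : ℕ → Run α} {g : Fin n → α} {F : (Fin n → α) → Run β}
    {b : β} {c c' : ℕ} (h : ∀ i : Fin n, Computes (f i) (g i) c) (hF : Computes (F g) b c') :
    Computes (build n f >>= F) b (n * (c + 2) + 1 + c') :=
  (computes_build h).bind hF

theorem computes_sumLoop {n : ℕ} {f : ℕ → Run ℝ} {g : Fin n → ℝ} {c : ℕ}
    (h : ∀ i : Fin n, Computes (f i) (g i) c) :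
    Computes (sumLoop n f) (∑ i, g i) (n * (c + 2) + 1) := by
  induction n with
  | zero =>
    exact (computes_step _).congr (by simp) (by simp)
  | succ n ih =>
    have hlast := h (Fin.last n)
    apply Computes.congr
    · apply (ih (g := fun i => g i.castSucc) fun i => h i.castSucc).bind
      apply hlast.bind
      apply (computes_tick 1).bind
      exact computes_add _ _
    · rw [Fin.sum_univ_castSucc]
    · linarith

theorem computes_vecAdd {n : ℕ} (a b : Fin n → ℝ) :
    Computes (vecAdd a b) (fun i => a i + b i) (n * 5 + 1) := by
  refine computes_build (c := 1 + (1 + 1)) fun i => ?_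
  apply (computes_get a i.2).bind
  apply (computes_get b i.2).bind
  exact computes_add _ _

theorem computes_vecSumLoop {n r : ℕ} {f : ℕ → Run (Fin n → ℝ)} {g : Fin r → Fin n → ℝ} {c : ℕ}
    (h : ∀ i : Fin r, Computes (f i) (g i) c) :
    Computes (vecSumLoop r f) (fun i => ∑ j, g j i) (n * 3 + 1 + r * (c + 5 * n + 2)) := by
  induction r with
  | zero =>
    exact (computes_build (g := fun _ => 0) fun _ => computes_step 0).congr (by simp) (by simp)
  | succ r ih =>
    have hlast := h (Fin.last r)
    apply Computes.congr
    · apply (ih (g := fun i => g i.castSucc) fun i => h i.castSucc).bind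
      apply hlast.bind
      apply (computes_tick 1).bind
      exact computes_vecAdd _ _
    · ext i
      rw [Fin.sum_univ_castSucc]
    · linarith

end Run

open Run

/-! ### The fast Fourier transform -/

theorem rootOfUnity_eq_pow (σ : ℝ) (j N : ℕ) : rootOfUnity σ j N = rootOfUnity σ 1 N ^ j := by
  rw [rootOfUnity, rootOfUnity, ← Complex.exp_nat_mul]
  congr 1
  push_cast
  ring

theorem rootOfUnity_add (σ : ℝ) (i j N : ℕ) :
    rootOfUnity σ (i + j) N = rootOfUnity σ i N * rootOfUnity σ j N := by
  rw [rootOfUnity_eq_pow σ (i + j), pow_add, ← rootOfUnity_eq_pow, ← rootOfUnity_eq_pow]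

theorem rootOfUnity_two_mul (σ : ℝ) (j N : ℕ) :
    rootOfUnity σ (2 * j) (2 * N) = rootOfUnity σ j N := by
  rw [rootOfUnity, rootOfUnity]
  congr 3
  push_cast
  rw [show σ * (2 * Real.pi * (2 * j)) = 2 * (σ * (2 * Real.pi * j)) by ring,
    mul_div_mul_left _ _ two_ne_zero]

theorem rootOfUnity_one_one (N : ℕ) :
    rootOfUnity 1 1 N = Complex.exp (2 * Real.pi * Complex.I / N) := by
  rw [rootOfUnity]
  congr 1
  push_cast
  ring

theorem rootOfUnity_neg_one (j N : ℕ) : rootOfUnity (-1) j N = (rootOfUnity 1 j N)⁻¹ := by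
  rw [rootOfUnity, rootOfUnity, ← Complex.exp_neg]
  congr 1
  push_cast
  ring

theorem isPrimitiveRoot_rootOfUnity {N : ℕ} (hN : N ≠ 0) :
    IsPrimitiveRoot (rootOfUnity 1 1 N) N := by
  rw [rootOfUnity_one_one]
  exact Complex.isPrimitiveRoot_exp N hN

/-- For general real `σ` these numbers are not `N`-th roots of unity; the sign condition makes them
so. -/
theorem rootOfUnity_self {σ : ℝ} (hσ : σ = 1 ∨ σ = -1) {N : ℕ} (hN : N ≠ 0) (k : ℕ) :
    rootOfUnity σ (N * k) N = 1 := by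
  have h : rootOfUnity 1 (N * k) N = 1 := by
    rw [rootOfUnity_eq_pow, pow_mul, (isPrimitiveRoot_rootOfUnity hN).pow_eq_one, one_pow]
  rcases hσ with rfl | rfl
  · exact h
  · rw [rootOfUnity_neg_one, h, inv_one]

theorem rootOfUnity_half {σ : ℝ} (hσ : σ = 1 ∨ σ = -1) {N : ℕ} (hN : N ≠ 0) :
    rootOfUnity σ N (2 * N) = -1 := by
  have hN' : (N : ℂ) ≠ 0 := by exact_mod_cast hN
  have h : rootOfUnity 1 N (2 * N) = -1 := by
    rw [rootOfUnity, ← Complex.exp_pi_mul_I]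
    congr 1
    push_cast
    field_simp
  rcases hσ with rfl | rfl
  · exact h
  · rw [rootOfUnity_neg_one, h, inv_neg, inv_one]

/-- The discrete Fourier transform of an array of length `N`. -/
def dft (σ : ℝ) {N : ℕ} (x : Fin N → ℂ) (l : ℕ) : ℂ :=
  ∑ j : Fin N, x j * rootOfUnity σ (j * l) N

theorem sum_fin_two_mul {M : Type*} [AddCommMonoid M] (N : ℕ) (f : ℕ → M) :
    ∑ j : Fin (2 * N), f j = ∑ j : Fin N, (f (2 * j) + f (2 * j + 1)) := by
  rw [Fin.sum_univ_eq_sum_range (fun j => f j),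
    Fin.sum_univ_eq_sum_range (fun j => f (2 * j) + f (2 * j + 1))]
  induction N with
  | zero => simp
  | succ N ih =>
    rw [Finset.sum_range_succ, ← ih, Nat.mul_succ, Finset.sum_range_succ, Finset.sum_range_succ,
      add_assoc]

/-- Cooley–Tukey splitting into even and odd indices; the odd part carries the twiddle factor. It
holds for every `σ` and every `l`, also beyond the half length. -/
theorem dft_succ (σ : ℝ) (L : ℕ) (x : Fin (2 ^ (L + 1)) → ℂ) (l : ℕ) :
    dft σ x l =
      dft σ (fun j : Fin (2 ^ L) => x ⟨2 * j, by have := j.2; rw [pow_succ]; omega⟩) l +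
        rootOfUnity σ l (2 ^ (L + 1)) *
          dft σ (fun j : Fin (2 ^ L) => x ⟨2 * j + 1, by have := j.2; rw [pow_succ]; omega⟩) l := by
  have hN : 2 ^ (L + 1) = 2 * 2 ^ L := by rw [pow_succ]; ring
  -- Extending the summand by zero to all of `ℕ` avoids casts between `Fin (2 ^ (L + 1))` and `Fin
  -- (2 * 2 ^ L)`.
  let f : ℕ → ℂ := fun j =>
    if h : j < 2 ^ (L + 1) then x ⟨j, h⟩ * rootOfUnity σ (j * l) (2 ^ (L + 1)) else 0
  have h0 : dft σ x l = ∑ j : Fin (2 * 2 ^ L), f j := by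
    rw [Fin.sum_univ_eq_sum_range f, ← hN, ← Fin.sum_univ_eq_sum_range f]
    exact Finset.sum_congr rfl fun j _ => by simp [f]
  rw [h0, sum_fin_two_mul, Finset.sum_add_distrib]
  congr 1
  · refine Finset.sum_congr rfl fun j _ => ?_
    have hj : 2 * (j : ℕ) < 2 ^ (L + 1) := by have := j.2; rw [pow_succ]; omega
    simp only [f, dif_pos hj]
    congr 1
    rw [hN, mul_assoc 2, rootOfUnity_two_mul]
  · rw [dft, Finset.mul_sum]
    refine Finset.sum_congr rfl fun j _ => ?_
    have hj : 2 * (j : ℕ) + 1 < 2 ^ (L + 1) := by have := j.2; rw [pow_succ]; omega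
    simp only [f, dif_pos hj]
    rw [mul_left_comm]
    congr 1
    rw [hN, show (2 * (j : ℕ) + 1) * l = 2 * (j * l) + l by ring, rootOfUnity_add,
      rootOfUnity_two_mul, mul_comm]

theorem dft_add_period {σ : ℝ} (hσ : σ = 1 ∨ σ = -1) {N : ℕ} (hN : N ≠ 0) (x : Fin N → ℂ)
    (l : ℕ) : dft σ x (l + N) = dft σ x l := by
  refine Finset.sum_congr rfl fun j _ => ?_
  rw [mul_add, rootOfUnity_add, mul_comm _ N, rootOfUnity_self hσ hN, mul_one]

/-- The cost recurrence is `t (L + 1) = 2 * t L + 35 * 2 ^ L + 4`, and the increment is at most `40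
* 2 ^ L`. -/
theorem computes_fft {σ : ℝ} (hσ : σ = 1 ∨ σ = -1) (L : ℕ) (x : Fin (2 ^ L) → ℂ) :
    Computes (fft σ L x) (fun l => dft σ x l) (20 * (L + 1) * 2 ^ L) := by
  induction L with
  | zero =>
    refine (computes_step x).congr ?_ (by simp)
    ext l
    have hl : l = 0 := Subsingleton.elim (α := Fin 1) l 0
    subst hl
    have : dft σ x 0 = x 0 * rootOfUnity σ 0 1 := by
      have h := Fin.sum_univ_one (fun j : Fin 1 => x j * rootOfUnity σ (j * 0) 1)
      exact h
    rw [show ((0 : Fin (2 ^ 0)) : ℕ) = 0 from rfl, this]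
    simp [rootOfUnity]
  | succ L ih =>
    have hN : 2 ^ (L + 1) = 2 * 2 ^ L := by rw [pow_succ]; ring
    have hlt : ∀ j : Fin (2 ^ L), 2 * (j : ℕ) + 1 < 2 ^ (L + 1) := fun j => by
      have := j.2
      omega
    have hpos : 0 < 2 ^ L := by positivity
    apply Computes.mono
    · apply Computes.build_bind (c := 2)
        (g := fun j : Fin (2 ^ L) => x ⟨2 * j, Nat.lt_of_succ_lt (hlt j)⟩)
      · intro j
        apply Computes.bind (c := 1) (c' := 1) (computes_mul 2 (j : ℕ))
        exact computes_get x (Nat.lt_of_succ_lt (hlt j))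
      apply Computes.build_bind (c := 3)
        (g := fun j : Fin (2 ^ L) => x ⟨2 * j + 1, hlt j⟩)
      · intro j
        apply Computes.bind (c := 1) (c' := 2) (computes_mul 2 (j : ℕ))
        apply Computes.bind (c := 1) (c' := 1) (computes_add _ 1)
        exact computes_get x (hlt j)
      apply Computes.bind (ih _)
      apply Computes.bind (ih _)
      apply Computes.build_bind (c := 10) (g := fun j : Fin (2 ^ L) =>
        rootOfUnity σ j (2 ^ (L + 1)) * dft σ (fun j : Fin (2 ^ L) => x ⟨2 * j + 1, hlt j⟩) j)
      · intro j
        apply Computes.bind (c := 8) (c' := 2) (computes_charge 8 _)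
        apply Computes.bind (c := 1) (c' := 1) (computes_get _ j.2)
        exact computes_mul _ _
      refine computes_build (c := 5) fun l => ?_
      refine Computes.branch (c := 4) (fun h => ?_) fun h => ?_
      · apply Computes.congr
        · apply Computes.bind (computes_get _ h)
          apply Computes.bind (computes_get _ h)
          exact computes_add _ _
        · exact (dft_succ σ L x l).symm
        · norm_num
      · have h' : (l : ℕ) - 2 ^ L < 2 ^ L := by have := l.2; omega
        apply Computes.congr
        · apply Computes.bind (computes_sub (l : ℕ) (2 ^ L))
          apply Computes.bind (computes_get _ h')
          apply Computes.bind (computes_get _ h')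
          exact computes_sub _ _
        -- Upper half of the butterfly: the half-length transforms are periodic and the twiddle
        -- factor changes sign.
        · obtain ⟨p, hp⟩ : ∃ p, (l : ℕ) = p + 2 ^ L := ⟨l - 2 ^ L, by omega⟩
          simp only [hp, Nat.add_sub_cancel]
          rw [dft_succ, dft_add_period hσ hpos.ne', dft_add_period hσ hpos.ne', rootOfUnity_add]
          rw [show rootOfUnity σ (2 ^ L) (2 ^ (L + 1)) = -1 by
            rw [hN, rootOfUnity_half hσ hpos.ne']]
          ring
        · norm_num
    · rw [hN]
      nlinarith

/-! ### Orthogonality and the convolution theorem. -/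

/-- A geometric sum with ratio `ξ = ζ ^ k / ζ ^ (p + q)`. As `p + q` and `k` are both below `N`,
primitivity of `ζ` gives `ξ = 1` only for `p + q = k`, not merely modulo `N`. -/
theorem sum_rootOfUnity {N p q k : ℕ} (hpq : p + q < N) (hk : k < N) :
    ∑ l : Fin N, rootOfUnity (-1) (p * l) N * rootOfUnity (-1) (q * l) N * rootOfUnity 1 (l * k) N =
      if p + q = k then (N : ℂ) else 0 := by
  have hN : N ≠ 0 := by omega
  have hζ := isPrimitiveRoot_rootOfUnity hN
  set ζ := rootOfUnity 1 1 N with hζdef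
  have hζ0 : ζ ≠ 0 := hζ.ne_zero hN
  set ξ := ζ ^ k / ζ ^ (p + q) with hξdef
  have hterm : ∀ l : Fin N, rootOfUnity (-1) (p * l) N * rootOfUnity (-1) (q * l) N *
      rootOfUnity 1 (l * k) N = ξ ^ (l : ℕ) := fun l => by
    rw [← rootOfUnity_add, ← add_mul, rootOfUnity_neg_one, rootOfUnity_eq_pow,
      rootOfUnity_eq_pow 1 (l * k), ← hζdef, hξdef, div_pow, ← pow_mul, ← pow_mul, mul_comm k,
      div_eq_mul_inv, mul_comm]
  rw [Finset.sum_congr rfl fun l _ => hterm l, Fin.sum_univ_eq_sum_range fun l => ξ ^ l]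
  split_ifs with h
  · have : ξ = 1 := by rw [hξdef, h, div_self (pow_ne_zero _ hζ0)]
    simp [this]
  · have hξ : ξ ≠ 1 := fun h1 => by
      rw [hξdef, div_eq_one_iff_eq (pow_ne_zero _ hζ0)] at h1
      exact h (hζ.pow_inj hpq hk h1.symm)
    have hξN : ξ ^ N = 1 := by
      rw [hξdef, div_pow, ← pow_mul, ← pow_mul, mul_comm k, mul_comm (p + q), pow_mul, pow_mul,
        hζ.pow_eq_one, one_pow, one_pow, div_one]
    rw [geom_sum_eq hξ, hξN, sub_self, zero_div]

/-- The hypothesis `hax` excludes wrap-around, so the cyclic convolution is the ordinary one. The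
factor `N` is the missing normalisation of the inverse transform. -/
theorem dft_one_mul_dft_neg_one {N : ℕ} (a x : Fin N → ℂ)
    (hax : ∀ p q : Fin N, N ≤ (p : ℕ) + q → a p * x q = 0) {k : ℕ} (hk : k < N) :
    dft 1 (fun l : Fin N => dft (-1) a l * dft (-1) x l) k =
      N * ∑ q : Fin N, ∑ p : Fin N, if (p : ℕ) + q = k then a p * x q else 0 := by
  have hexp : dft 1 (fun l : Fin N => dft (-1) a l * dft (-1) x l) k =
      ∑ q : Fin N, ∑ p : Fin N, a p * x q * ∑ l : Fin N, rootOfUnity (-1) (p * l) N *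
        rootOfUnity (-1) (q * l) N * rootOfUnity 1 (l * k) N := by
    rw [dft]
    simp only [Finset.mul_sum]
    rw [Finset.sum_congr rfl fun q _ => Finset.sum_comm, Finset.sum_comm]
    refine Finset.sum_congr rfl fun l _ => ?_
    rw [dft, dft, Finset.sum_mul_sum, Finset.sum_comm, Finset.sum_mul]
    refine Finset.sum_congr rfl fun q _ => ?_
    rw [Finset.sum_mul]
    exact Finset.sum_congr rfl fun p _ => by ring
  rw [hexp, Finset.mul_sum]
  refine Finset.sum_congr rfl fun q _ => ?_
  rw [Finset.mul_sum]
  refine Finset.sum_congr rfl fun p _ => ?_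
  by_cases hpq : (p : ℕ) + q < N
  · rw [sum_rootOfUnity hpq hk]
    split_ifs
    · ring
    · simp
  · rw [hax p q (by omega)]
    simp

/-! ### Fast multiplication by a sub-convolution matrix. -/

/-- The matrix `conv(a, m)`: its lower right `m × m` block is the lower triangular Toeplitz matrix
with first column `a 0, …, a (m - 1)`, and its other entries are `0`. -/
def subConv {n : ℕ} (a : Fin n → ℝ) (m : ℕ) : Matrix (Fin n) (Fin n) ℝ :=
  Matrix.of fun i j => if n - m ≤ j ∧ j ≤ i then a ⟨i - j, by omega⟩ else 0

/-- Substituting `j = n - m + q` turns the row sum into the convolution of the zero-padded arrays;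
padding indices `q ≥ m` drop out because `k < m`. -/
theorem subConv_mulVec_apply {n m : ℕ} (a x : Fin n → ℝ) (hm : m ≤ n) {N k : ℕ} (hN : m ≤ N)
    (hk : k < m) :
    ∑ q : Fin N, ∑ p : Fin N, (if (p : ℕ) + q = k then
        (if h : (p : ℕ) < m then a ⟨p, by omega⟩ else 0) *
          (if h : (q : ℕ) < m then x ⟨n - m + q, by omega⟩ else 0) else 0) =
      (subConv a m *ᵥ x) ⟨n - m + k, by omega⟩ := by
  let A : ℕ → ℝ := fun p => if h : p < m then a ⟨p, by omega⟩ else 0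
  let X : ℕ → ℝ := fun q => if h : q < m then x ⟨n - m + q, by omega⟩ else 0
  have hl : ∀ q : Fin N, (∑ p : Fin N, if (p : ℕ) + q = k then A p * X q else 0) =
      if (q : ℕ) ≤ k then A (k - q) * X q else 0 := fun q => by
    split_ifs with h
    · rw [Finset.sum_eq_single ⟨k - q, by omega⟩, if_pos (by simp; omega)]
      · intro p _ hp
        rw [if_neg fun h' => hp (Fin.ext (by simp; omega))]
      · simp
    · exact Finset.sum_eq_zero fun p _ => if_neg (by omega)
  have hr : (subConv a m *ᵥ x) ⟨n - m + k, by omega⟩ = ∑ j : Fin n,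
      if n - m ≤ j ∧ (j : ℕ) ≤ n - m + k then A (n - m + k - j) * X (j - (n - m)) else 0 := by
    rw [Matrix.mulVec, dotProduct]
    refine Finset.sum_congr rfl fun j _ => ?_
    simp only [subConv, Matrix.of_apply, Fin.le_def]
    by_cases h : n - m ≤ j ∧ (j : ℕ) ≤ n - m + k
    · have h1 : n - m + k - (j : ℕ) < m := by omega
      have h2 : (j : ℕ) - (n - m) < m := by omega
      simp only [if_pos h, A, X, dif_pos h1, dif_pos h2]
      congr 2
      exact Fin.ext (by simp; omega)
    · simp only [if_neg h, zero_mul]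
  rw [hr, Finset.sum_congr rfl fun q _ => hl q,
    Fin.sum_univ_eq_sum_range (fun q => if q ≤ k then A (k - q) * X q else 0),
    Fin.sum_univ_eq_sum_range (fun j => if n - m ≤ j ∧ j ≤ n - m + k then
      A (n - m + k - j) * X (j - (n - m)) else 0)]
  obtain ⟨N, rfl⟩ := Nat.exists_eq_add_of_le hN
  have htail : (∑ q ∈ Finset.range N, if m + q ≤ k then A (k - (m + q)) * X (m + q) else 0) = 0 :=
    Finset.sum_eq_zero fun q _ => if_neg (by omega)
  have hshift : ∀ off : ℕ, (∑ q ∈ Finset.range m, if q ≤ k then A (k - q) * X q else 0) =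
      ∑ j ∈ Finset.range (off + m), if off ≤ j ∧ j ≤ off + k then
        A (off + k - j) * X (j - off) else 0 := fun off => by
    rw [Finset.sum_range_add, Finset.sum_eq_zero (s := Finset.range off) fun j hj =>
      if_neg fun h => by have := Finset.mem_range.1 hj; omega, zero_add]
    refine Finset.sum_congr rfl fun q _ => ?_
    simp [Nat.add_sub_add_left]
  have h := hshift (n - m)
  rw [Nat.sub_add_cancel hm] at h
  rw [Finset.sum_range_add, htail, add_zero, h]

theorem two_pow_clog_le {n m : ℕ} (hm : 1 ≤ m) (hmn : m ≤ n) : 2 ^ Nat.clog 2 (2 * m) ≤ 4 * n := by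
  have h := Nat.pow_pred_clog_lt_self one_lt_two (show 1 < 2 * m by omega)
  have h0 : 0 < Nat.clog 2 (2 * m) := Nat.clog_pos one_lt_two (by omega)
  obtain ⟨L, hL⟩ := Nat.exists_eq_succ_of_ne_zero h0.ne'
  rw [hL] at h ⊢
  rw [Nat.pred_succ] at h
  rw [pow_succ]
  omega

/-- Padding to length at least `2 * m` prevents wrap-around. Three transforms of length at most `4 *
n` give the coefficient `240`; the linear loops and overhead fit into the remaining `90`. -/
theorem computes_subConvMul {n m : ℕ} (a x : Fin n → ℝ) (hm : 1 ≤ m) (hmn : m ≤ n) :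
    Computes (subConvMul a m x) (subConv a m *ᵥ x) (330 * (Nat.clog 2 (2 * n) + 1) * n) := by
  have hL : Nat.clog 2 (2 * m) ≤ Nat.clog 2 (2 * n) := Nat.clog_mono_right 2 (by omega)
  have hN := two_pow_clog_le hm hmn
  have hmN : 2 * m ≤ 2 ^ Nat.clog 2 (2 * m) := Nat.le_pow_clog one_lt_two _
  have hL0 : ((2 ^ Nat.clog 2 (2 * m) : ℕ) : ℂ) ≠ 0 := Nat.cast_ne_zero.2 (by positivity)
  rw [subConvMul]
  generalize Nat.clog 2 (2 * m) = L at hL hN hmN hL0 ⊢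
  apply Computes.mono
  · apply Computes.bind (computes_charge _ _)
    apply Computes.bind (computes_sub n m)
    apply Computes.build_bind (c := 5) (g := fun p : Fin (2 ^ L) =>
      ((if h : (p : ℕ) < m then a ⟨p, by omega⟩ else 0 : ℝ) : ℂ))
    · intro p
      refine Computes.branch (c := 4) (fun h => ?_) fun h => ?_
      · rw [dif_pos h]
        refine Computes.mono (c := 2) ?_ (by norm_num)
        apply Computes.bind (c := 1) (c' := 1) (computes_get a (show (p : ℕ) < n by omega))
        exact computes_step _
      · rw [dif_neg h, Complex.ofReal_zero]
        exact (computes_step _).mono (by norm_num)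
    apply Computes.build_bind (c := 5) (g := fun q : Fin (2 ^ L) =>
      ((if h : (q : ℕ) < m then x ⟨n - m + q, by omega⟩ else 0 : ℝ) : ℂ))
    · intro p
      refine Computes.branch (c := 4) (fun h => ?_) fun h => ?_
      · rw [dif_pos h]
        refine Computes.mono (c := 3) ?_ (by norm_num)
        apply Computes.bind (c := 1) (c' := 2) (computes_add (n - m) (p : ℕ))
        apply Computes.bind (c := 1) (c' := 1) (computes_get x (show n - m + (p : ℕ) < n by omega))
        exact computes_step _
      · rw [dif_neg h, Complex.ofReal_zero]
        exact (computes_step _).mono (by norm_num)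
    apply Computes.bind (computes_fft (Or.inr rfl) L _)
    apply Computes.bind (computes_fft (Or.inr rfl) L _)
    apply Computes.build_bind (c := 3)
    · intro p
      apply Computes.bind (c := 1) (c' := 2) (computes_get _ p.2)
      apply Computes.bind (c := 1) (c' := 1) (computes_get _ p.2)
      exact computes_mul _ _
    apply Computes.bind (computes_fft (Or.inl rfl) L _)
    refine computes_build (c := 5) fun i => ?_
    refine Computes.branch (c := 4) (fun h => ?_) fun h => ?_
    · refine (computes_step 0).congr ?_ (by norm_num)
      rw [Matrix.mulVec, dotProduct]
      refine (Finset.sum_eq_zero fun j _ => ?_).symm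
      simp only [subConv, Matrix.of_apply, Fin.le_def]
      rw [if_neg (by omega), zero_mul]
    · obtain ⟨k, hk, rfl⟩ : ∃ k, ∃ hk : n - m + k < n, i = ⟨n - m + k, hk⟩ :=
        ⟨i - (n - m), by omega, Fin.ext (by simp; omega)⟩
      have hkm : k < m := by omega
      apply Computes.congr
      · apply Computes.bind (computes_sub _ _)
        apply Computes.bind (computes_get _ (show n - m + k - (n - m) < 2 ^ L by omega))
        apply Computes.bind (computes_div _ hL0)
        exact computes_step _
      · simp only [Nat.add_sub_cancel_left]
        rw [dft_one_mul_dft_neg_one _ _ ?_ (show k < 2 ^ L by omega),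
          mul_div_cancel_left₀ _ hL0, ← subConv_mulVec_apply a x hmn
            (show m ≤ 2 ^ L by omega) hkm]
        -- The complex double sum is the cast of the real one, so its real part loses nothing.
        · rw [← Complex.ofReal_re (∑ q, _)]
          congr 1
          push_cast
          refine Finset.sum_congr rfl fun q _ => Finset.sum_congr rfl fun p _ => ?_
          split_ifs <;> simp
        · intro p q hpq
          by_cases hp : (p : ℕ) < m
          · rw [dif_neg (show ¬ (q : ℕ) < m by omega), Complex.ofReal_zero, mul_zero]
          · rw [dif_neg hp, Complex.ofReal_zero, zero_mul]
      · norm_num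
  · generalize Nat.clog 2 (2 * n) = L' at hL ⊢
    generalize 2 ^ L = N at hN ⊢
    have h1 : (L + 1) * N ≤ (L' + 1) * (4 * n) := Nat.mul_le_mul (by omega) hN
    have h2 : L' ≤ L' * n := Nat.le_mul_of_pos_right _ (by omega)
    nlinarith

variable {n d : ℕ}

/-! ### Recovery of the basis when every probe succeeds -/

/-- The masked logits `M ∘ (Q Kᵀ)`. -/
def logits (Q K : Matrix (Fin n) (Fin d) ℝ) : Matrix (Fin n) (Fin n) ℝ :=
  Matrix.hadamard (causalMask n) (Q * Kᵀ)

theorem computes_column (Q K : Matrix (Fin n) (Fin d) ℝ) {j : ℕ} (hj : j < n) :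
    Computes (column Q K (j + 1)) (fun i => logits Q K i ⟨j, hj⟩) (n * (5 * d + 5) + 2) := by
  rw [column]
  apply Computes.mono
  · apply Computes.bind (computes_sub (j + 1) 1)
    refine computes_build (c := d * (3 + 2) + 1 + 2) fun i => ?_
    apply Computes.bind (c' := 2)
      (computes_sumLoop (c := 3) (g := fun l => Q i l * K ⟨j, hj⟩ l) fun l => ?_)
    · apply Computes.bind (c := 1) (c' := 1) (computes_entry (causalMask n) i.2 hj)
      exact computes_mul _ _
    · apply Computes.bind (c := 1) (c' := 2) (computes_entry Q i.2 l.2)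
      apply Computes.bind (c := 1) (c' := 1) (computes_entry K hj l.2)
      exact computes_mul _ _
  · linarith

/-- The threshold is `-2 * ε ≤ 0` and an `ℓ¹` norm is nonnegative, so the test passes whatever `v`
is. -/
theorem computes_probe (Q K : Matrix (Fin n) (Fin d) ℝ) {ε : ℝ} (hε : 0 ≤ ε) (v : Fin 1 → ℝ)
    {j : ℕ} (hj : j < n) :
    Computes (probe Q K 1 0 ε v (j + 1)) true (n * (5 * d + 5) + 15) := by
  rw [probe]
  apply Computes.congr
  · apply Computes.bind (computes_column Q K hj)
    apply Computes.bind (computes_sub (j + 1) 1)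
    apply Computes.bind (computes_sumLoop (c := 5) (g := fun p : Fin 1 =>
      |logits Q K ⟨j, hj⟩ ⟨j, hj⟩ - v p|) fun p => ?_)
    · apply Computes.bind (computes_mul _ _)
      apply Computes.bind (computes_mul _ _)
      apply Computes.bind (computes_sub _ _)
      exact computes_le _ _
    · obtain rfl : p = 0 := Subsingleton.elim _ _
      apply Computes.bind (c := 1) (c' := 4) (computes_add _ _)
      apply Computes.bind (c := 1) (c' := 3) (computes_get _ hj)
      apply Computes.bind (c := 1) (c' := 2) (computes_get _ (Nat.zero_lt_one))
      apply Computes.bind (c := 1) (c' := 1) (computes_sub _ _)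
      exact computes_abs _
  · have h : 0 ≤ ∑ p : Fin 1, |logits Q K ⟨j, hj⟩ ⟨j, hj⟩ - v p| :=
      Finset.sum_nonneg fun p _ => abs_nonneg _
    refine decide_eq_true (le_trans ?_ h)
    simp [hε]
  · linarith

/-- Only the right end ever moves, and each probe halves `t - s`, so `e` probes suffice. The
condition `1 ≤ s` keeps midpoints at valid one-based positions. -/
theorem computes_search (Q K : Matrix (Fin n) (Fin d) ℝ) {ε : ℝ} (hε : 0 ≤ ε) (v : Fin 1 → ℝ)
    {s t e : ℕ} (hs : 1 ≤ s) (ht : t ≤ n) (he : t - s < 2 ^ e) :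
    Computes (search Q K 1 0 ε v s t) s (e * (n * (5 * d + 5) + 18) + 1) := by
  induction e generalizing t with
  | zero =>
    rw [search, dif_pos (by simp at he; omega)]
    exact (computes_step s).mono (by omega)
  | succ e ih =>
    rw [search]
    split_ifs with h
    · exact (computes_step s).mono (by omega)
    · obtain ⟨j, hj⟩ : ∃ j, (s + t) / 2 = j + 1 := ⟨(s + t) / 2 - 1, by omega⟩
      rw [pow_succ] at he
      have hjt : j + 1 ≤ n := by omega
      have hje : j + 1 - s < 2 ^ e := by omega
      rw [hj]
      apply Computes.mono
      · apply Computes.bind (computes_tick 3)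
        apply Computes.bind (computes_probe Q K hε v hjt)
        exact ih hjt hje
      · linarith

/-- The vector `u` after `i` rounds in which position `i` is found in round `i`. -/
def runningSum (Q K : Matrix (Fin n) (Fin d) ℝ) : ℕ → Fin n → ℝ
  | 0, _ => 0
  | i + 1, p => if h : i + p < n then logits Q K ⟨i + p, h⟩ ⟨i, by omega⟩ else runningSum Q K i p

/-- The vectors `b'` found by the algorithm if position `i` is found in round `i`. -/
def increments (Q K : Matrix (Fin n) (Fin d) ℝ) (k : ℕ) : Fin k → Fin n → ℝ :=
  fun j p => runningSum Q K (j + 1) p - runningSum Q K j p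

/-- The search runs from `i + 1` to `n` and returns `i + 1`, giving block size `n - i`. The new `v`
is left existential because it never influences a probe. -/
theorem computes_recoverRound (Q K : Matrix (Fin n) (Fin d) ℝ) {ε : ℝ} (hε : 0 ≤ ε) {i e : ℕ}
    (hi : i < n) (he : n < 2 ^ e) (v : Fin 1 → ℝ) :
    ∃ v', Computes (recoverRound Q K 0 ε n
        ⟨v, runningSum Q K i, i, increments Q K i, fun j => n - j⟩)
      ⟨v', runningSum Q K (i + 1), i + 1, increments Q K (i + 1), fun j => n - j⟩
      ((e + 1) * (n * (5 * d + 5) + 18) + 12 * n + 20) := by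
  refine ⟨fun p => v p + increments Q K (i + 1) (Fin.last i) ⟨p, by omega⟩, ?_⟩
  rw [recoverRound]
  apply Computes.congr
  · apply Computes.bind (computes_add _ _)
    apply Computes.bind (computes_search Q K hε v (show 1 ≤ i + 1 by omega) le_rfl
      (show n - (i + 1) < 2 ^ e by omega))
    apply Computes.bind (computes_add _ _)
    apply Computes.bind (computes_sub _ _)
    apply Computes.bind (computes_column Q K hi)
    apply Computes.bind (computes_sub _ _)
    apply Computes.build_bind (c := 5) (g := increments Q K (i + 1) (Fin.last i))
    · intro p
      refine Computes.branch (c := 4) (fun h => ?_) fun h => ?_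
      · have h' : i + (p : ℕ) < n := by omega
        apply Computes.congr
        · apply Computes.bind (computes_add _ _)
          apply Computes.bind (computes_get _ (show i + 1 - 1 + (p : ℕ) < n from h'))
          apply Computes.bind (computes_get _ p.2)
          exact computes_sub _ _
        · simp [increments, runningSum, h']
        · norm_num
      · have h' : ¬ i + (p : ℕ) < n := by omega
        refine (computes_step 0).congr ?_ (by norm_num)
        simp [increments, runningSum, h']
    apply Computes.build_bind (c := 3)
      (g := fun p : Fin 1 => v p + increments Q K (i + 1) (Fin.last i) ⟨p, by omega⟩)
    · intro p
      apply Computes.bind (c := 1) (c' := 2) (computes_get _ p.2)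
      apply Computes.bind (c := 1) (c' := 1) (computes_get _ (show (p : ℕ) < n by omega))
      exact computes_add _ _
    apply Computes.bind (computes_vecAdd _ _)
    apply Computes.bind (computes_tick 2)
    exact computes_pure _
  · congr 1
    · ext p
      simp [increments]
    · exact Fin.snoc_init_self (α := fun _ => Fin n → ℝ) (increments Q K (i + 1))
    · rw [Nat.add_sub_add_right]
      exact Fin.snoc_init_self (α := fun _ => ℕ) (fun j : Fin (i + 1) => n - (j : ℕ))
  · linarith

theorem computes_recoverLoop (Q K : Matrix (Fin n) (Fin d) ℝ) {ε : ℝ} (hε : 0 ≤ ε) {e : ℕ}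
    (he : n < 2 ^ e) {i : ℕ} (hi : i ≤ n) :
    ∃ v, Computes (recoverLoop Q K 1 0 ε n i)
      ⟨v, runningSum Q K i, i, increments Q K i, fun j => n - j⟩
      (3 * n + 6 + i * ((e + 1) * (n * (5 * d + 5) + 18) + 12 * n + 21)) := by
  induction i with
  | zero =>
    refine ⟨fun _ => 0, ?_⟩
    rw [recoverLoop]
    apply Computes.congr
    · apply Computes.build_bind (c := 1) (g := fun _ => 0)
      · exact fun _ => computes_step 0
      apply Computes.build_bind (c := 1) (g := fun _ => 0)
      · exact fun _ => computes_step 0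
      apply Computes.bind (computes_tick 1)
      exact computes_pure _
    · congr 1 <;> exact Subsingleton.elim _ _
    · linarith
  | succ i ih =>
    obtain ⟨v, hv⟩ := ih (by omega)
    obtain ⟨v', hv'⟩ := computes_recoverRound Q K hε (show i < n by omega) he v
    refine ⟨v', ?_⟩
    rw [recoverLoop]
    apply Computes.mono
    · apply Computes.bind hv
      apply Computes.bind (computes_tick 1)
      exact hv'
    · linarith

/-- The vectors `b̃` belonging to `increments`. -/
def expIncrements (Q K : Matrix (Fin n) (Fin d) ℝ) (k : ℕ) : Fin k → Fin n → ℝ :=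
  fun j p => Real.exp (runningSum Q K (j + 1) p) -
    if 0 < (j : ℕ) then Real.exp (runningSum Q K j p) else 0

theorem computes_expBasis (Q K : Matrix (Fin n) (Fin d) ℝ) {k r : ℕ} (hr : r ≤ k) :
    Computes (expBasis (increments Q K k) r) (runningSum Q K r, expIncrements Q K r)
      (3 * n + 1 + r * (13 * n + 5)) := by
  induction r with
  | zero =>
    rw [expBasis]
    apply Computes.congr
    · apply Computes.build_bind (c := 1) (g := fun _ => 0)
      · exact fun _ => computes_step 0
      exact computes_pure _
    · exact Prod.ext rfl (Subsingleton.elim _ _)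
    · linarith
  | succ r ih =>
    rw [expBasis]
    apply Computes.congr
    · apply Computes.bind (ih (by omega))
      apply Computes.bind (computes_get _ (show r < k by omega))
      apply Computes.bind (computes_vecAdd _ _)
      apply Computes.build_bind (c := 6) (g := expIncrements Q K (r + 1) (Fin.last r))
      · intro l
        have hl : runningSum Q K r l + increments Q K k ⟨r, by omega⟩ l =
            runningSum Q K (r + 1) l := by simp [increments]
        apply Computes.bind (c := 1) (c' := 5) (computes_get _ l.2)
        apply Computes.bind (c := 1) (c' := 4) (computes_exp _)
        refine Computes.branch (c := 3) (fun h => ?_) fun h => ?_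
        · apply Computes.congr
          · apply Computes.bind (computes_get _ l.2)
            apply Computes.bind (computes_exp _)
            exact computes_sub _ _
          · simp [expIncrements, h, hl]
          · norm_num
        · refine (computes_pure _).congr ?_ (by norm_num)
          simp [expIncrements, h, hl]
      apply Computes.bind (computes_tick 2)
      exact computes_pure _
    · refine Prod.ext ?_ ?_
      · ext p
        simp [increments]
      · exact Fin.snoc_init_self (α := fun _ => Fin n → ℝ) (expIncrements Q K (r + 1))
    · linarith

theorem computes_recover (Q K : Matrix (Fin n) (Fin d) ℝ) {ε : ℝ} (hε : 0 ≤ ε) {e : ℕ}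
    (he : n < 2 ^ e) :
    Computes (recover Q K n 1 0 ε) (expIncrements Q K n, fun j => n - j)
      (n * ((e + 1) * (n * (5 * d + 5) + 18) + 25 * n + 26) + 6 * n + 9) := by
  obtain ⟨v, hv⟩ := computes_recoverLoop Q K hε he le_rfl
  rw [recover]
  apply Computes.mono
  · apply Computes.bind (computes_add _ _)
    apply Computes.bind (computes_sub _ _)
    apply Computes.bind hv
    apply Computes.bind (computes_expBasis Q K le_rfl)
    exact computes_pure _
  · linarith

theorem computes_basisMul {k : ℕ} (b : Fin k → Fin n → ℝ) (m : Fin k → ℕ) (x : Fin n → ℝ)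
    (hm : ∀ r, 1 ≤ m r ∧ m r ≤ n) :
    Computes (basisMul b m x) (fun i => ∑ r, (subConv (b r) (m r) *ᵥ x) i)
      (n * 3 + 1 + k * (330 * (Nat.clog 2 (2 * n) + 1) * n + 5 * n + 4)) := by
  apply Computes.mono
  · refine computes_vecSumLoop (c := 1 + (1 + 330 * (Nat.clog 2 (2 * n) + 1) * n)) fun r => ?_
    apply Computes.bind (computes_get _ r.2)
    apply Computes.bind (computes_get _ r.2)
    exact computes_subConvMul _ x (hm r).1 (hm r).2
  · linarith

/-! ### Exactness -/

theorem sum_range_exp_sub (f : ℕ → ℝ) (j : ℕ) :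
    ∑ r ∈ Finset.range (j + 1),
      (Real.exp (f (r + 1)) - if 0 < r then Real.exp (f r) else 0) = Real.exp (f (j + 1)) := by
  induction j with
  | zero => simp
  | succ j ih => rw [Finset.sum_range_succ, ih, if_pos j.succ_pos, add_sub_cancel]

/-- At an entry with `j ≤ i`, exactly the blocks `r ≤ j` contribute, all at offset `i - j`. Their
sum telescopes to the exponential of `u` at that offset after round `j`, which that round has just
set to the logit at `(i, j)`. -/
theorem sum_subConv_expIncrements (Q K : Matrix (Fin n) (Fin d) ℝ) :
    ∑ r : Fin n, subConv (expIncrements Q K n r) (n - r) = attnMatrix Q K := by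
  ext i j
  rw [Matrix.sum_apply]
  simp only [subConv, Matrix.of_apply, Nat.sub_sub_self (Fin.is_lt _).le]
  by_cases h : j ≤ i
  · simp only [h, and_true, expIncrements]
    rw [Fin.sum_univ_eq_sum_range (fun r => if r ≤ (j : ℕ) then
      Real.exp (runningSum Q K (r + 1) ⟨i - j, by omega⟩) -
        (if 0 < r then Real.exp (runningSum Q K r ⟨i - j, by omega⟩) else 0) else 0),
      ← Finset.sum_subset (Finset.range_mono (show (j : ℕ) + 1 ≤ n from j.2))
        fun r _ hr => if_neg fun h' => hr (Finset.mem_range.2 (by omega)),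
      Finset.sum_congr rfl fun r hr => if_pos (Nat.lt_succ_iff.1 (Finset.mem_range.1 hr))]
    refine (sum_range_exp_sub (fun r => runningSum Q K r ⟨i - j, by omega⟩) j).trans ?_
    have hij : (j : ℕ) + (i - j) = i := by rw [Fin.le_def] at h; omega
    simp [runningSum, hij, logits, attnMatrix, causalMask, h]
  · simp [h, attnMatrix, causalMask]

/-- The diagonal entry of each row survives the mask. This inverts `D` and keeps the final division
from aborting. -/
theorem attnMatrix_mulVec_one_pos (Q K : Matrix (Fin n) (Fin d) ℝ) (i : Fin n) :
    0 < (attnMatrix Q K *ᵥ fun _ => 1) i := by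
  rw [Matrix.mulVec, dotProduct]
  refine Finset.sum_pos' (fun j _ => ?_) ⟨i, Finset.mem_univ _, ?_⟩
  · simp only [attnMatrix, causalMask, Matrix.hadamard_apply, Matrix.of_apply, Matrix.map_apply]
    split_ifs <;> positivity
  · simp only [attnMatrix, causalMask, Matrix.hadamard_apply, Matrix.of_apply, Matrix.map_apply,
      le_refl, if_true]
    positivity

theorem attention_apply (Q K V : Matrix (Fin n) (Fin d) ℝ) (i : Fin n) (c : Fin d) :
    attention Q K V i c =
      (attnMatrix Q K *ᵥ fun j => V j c) i / (attnMatrix Q K *ᵥ fun _ => 1) i := by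
  have hinv : (Matrix.diagonal (attnMatrix Q K *ᵥ fun _ => 1))⁻¹ =
      Matrix.diagonal fun i => ((attnMatrix Q K *ᵥ fun _ => 1) i)⁻¹ := by
    refine Matrix.inv_eq_left_inv ?_
    rw [Matrix.diagonal_mul_diagonal, ← Matrix.diagonal_one]
    congr 1
    ext i
    exact inv_mul_cancel₀ (attnMatrix_mulVec_one_pos Q K i).ne'
  rw [attention, hinv, Matrix.mul_assoc, Matrix.diagonal_mul, div_eq_inv_mul]
  rfl

/-! ### The whole algorithm: output and total cost. -/

theorem computes_convForward (hn : 1 ≤ n) (Q K V : Matrix (Fin n) (Fin d) ℝ) {ε : ℝ}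
    (hε : 0 ≤ ε) :
    Computes (convForward Q K V n 1 0 ε) (attention Q K V)
      (1000 * (Nat.clog 2 (2 * n) + 1) * n ^ 2 * (d + 1)) := by
  have he : 2 * n ≤ 2 ^ Nat.clog 2 (2 * n) := Nat.le_pow_clog one_lt_two _
  have hmul : ∀ x : Fin n → ℝ, Computes (basisMul (expIncrements Q K n) (fun j => n - j) x)
      (attnMatrix Q K *ᵥ x)
      (n * 3 + 1 + n * (330 * (Nat.clog 2 (2 * n) + 1) * n + 5 * n + 4)) := fun x => by
    refine (computes_basisMul _ _ x fun r => by omega).congr ?_ le_rfl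
    rw [← sum_subConv_expIncrements, Matrix.sum_mulVec]
    ext i
    rw [Finset.sum_apply]
  rw [convForward]
  apply Computes.congr
  · apply Computes.bind (computes_recover Q K hε (show n < 2 ^ Nat.clog 2 (2 * n) by omega))
    apply Computes.build_bind (c := 1) (g := fun _ => 1)
    · exact fun _ => computes_step 1
    apply Computes.bind (hmul _)
    apply Computes.build_bind
      (c := n * 3 + 1 + (n * 3 + 1 + n * (330 * (Nat.clog 2 (2 * n) + 1) * n + 5 * n + 4)))
      (g := fun c => attnMatrix Q K *ᵥ fun j => V j c)
    · intro c
      apply Computes.build_bind (c := 1) (g := fun j => V j c)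
      · exact fun j => computes_entry V j.2 c.2
      exact hmul _
    apply Computes.build_bind (c := 5 * d + 2) (g := attention Q K V)
    · intro i
      apply Computes.mono
      · apply Computes.bind (computes_get _ i.2)
        refine computes_build (c := 3) fun c => ?_
        rw [attention_apply]
        apply Computes.bind (c := 1) (c' := 2) (computes_get _ c.2)
        apply Computes.bind (c := 1) (c' := 1) (computes_get _ i.2)
        exact computes_div _ (attnMatrix_mulVec_one_pos Q K i).ne'
      · linarith
    exact computes_pure _
  · rfl
  -- Every lower-order term is absorbed into `M * n ^ 2` or `d * (M * n ^ 2)`, with `M` the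
  -- logarithmic factor.
  · have hM : 1 ≤ Nat.clog 2 (2 * n) + 1 := by omega
    generalize Nat.clog 2 (2 * n) + 1 = M at hM ⊢
    have h1 : n ≤ n ^ 2 := Nat.le_self_pow two_ne_zero n
    have h2 : n ^ 2 ≤ M * n ^ 2 := Nat.le_mul_of_pos_left _ hM
    have h3 : M * n ≤ M * n ^ 2 := Nat.mul_le_mul_left M h1
    have h4 : n * 3 + 1 + n * (330 * M * n + 5 * n + 4) ≤ 343 * (M * n ^ 2) := by linarith
    have h5 : d * (n * 3 + 1 + (n * 3 + 1 + n * (330 * M * n + 5 * n + 4)) + 2) ≤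
        d * (349 * (M * n ^ 2)) := Nat.mul_le_mul_left d (by linarith)
    have h6 : d * n ≤ d * (M * n ^ 2) := Nat.mul_le_mul_left d (h1.trans h2)
    have h7 : 0 ≤ d * (M * n ^ 2) := Nat.zero_le _
    linarith

/-- The left side is at most `3 + log₂ n`, hence at most `4 * log₂ n` as `n ≥ 2`, and `4 / log 2 <
8`. -/
theorem clog_add_one_le_log (hn : 2 ≤ n) :
    (Nat.clog 2 (2 * n) : ℝ) + 1 ≤ 8 * Real.log n := by
  have h2 : Real.log 2 ≤ Real.log n := Real.log_le_log two_pos (by exact_mod_cast hn)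
  have h : (2 : ℝ) ^ Nat.clog 2 (2 * n) ≤ 2 ^ 2 * n := by
    norm_num
    exact_mod_cast two_pow_clog_le (show 1 ≤ n by omega) le_rfl
  have h' := Real.log_le_log (by positivity) h
  rw [Real.log_pow, Real.log_mul (by norm_num) (by positivity), Real.log_pow] at h'
  push_cast at h'
  nlinarith [Real.log_two_gt_d9, (Nat.cast_nonneg (Nat.clog 2 (2 * n)) : (0 : ℝ) ≤ _)]

end ConvAttn

end

theorem corollary4p5 :
    (∀ (n d : ℕ), 1 ≤ n → ∀ (Q K V : Matrix (Fin n) (Fin d) ℝ) (ε : ℝ), 0 ≤ ε →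
      ∃ (k T : ℕ) (δ : ℝ), k ∈ Set.Icc 1 n ∧ T ∈ Set.Icc 1 n ∧ 0 ≤ δ ∧
        ∃ Y' : Matrix (Fin n) (Fin d) ℝ,
          (ConvAttn.convForward Q K V k T δ ε).out = some Y' ∧
          ‖ConvAttn.attention Q K V - Y'‖ ≤ 2 * (Real.exp (2 * ε) - 1) * ‖V‖) ∧
    (∃ C : ℝ, ∀ n : ℕ, 1 ≤ n →
      ∃ (k T : ℕ) (δ : ℝ), k ∈ Set.Icc 1 n ∧ T ∈ Set.Icc 1 n ∧ 0 ≤ δ ∧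
        ∀ (d : ℕ) (Q K V : Matrix (Fin n) (Fin d) ℝ),
          (ConvAttn.convForward Q K V k T δ 0).out = some (ConvAttn.attention Q K V) ∧
          (2 ≤ n → 1 ≤ d →
            ((ConvAttn.convForward Q K V k T δ 0).time : ℝ) ≤
              C * (n : ℝ) ^ 2 * (d : ℝ) * Real.log n)) := by
  -- The constant is `16000 = 1000 * 8 * 2`: the step bound, the passage to the natural logarithm,
  -- and `d + 1 ≤ 2 * d`.
  refine ⟨fun n d hn Q K V ε hε => ⟨n, 1, 0, ⟨hn, le_rfl⟩, ⟨le_rfl, hn⟩, le_rfl, _,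
    (ConvAttn.computes_convForward hn Q K V hε).1, ?_⟩, 16000, fun n hn => ⟨n, 1, 0,
    ⟨hn, le_rfl⟩, ⟨le_rfl, hn⟩, le_rfl, fun d Q K V => ?_⟩⟩
  · rw [sub_self, norm_zero]
    have h : 1 ≤ Real.exp (2 * ε) := Real.one_le_exp (by positivity)
    exact mul_nonneg (by linarith) (norm_nonneg V)
  · obtain ⟨h1, h2⟩ := ConvAttn.computes_convForward hn Q K V le_rfl
    refine ⟨h1, fun hn2 hd => ?_⟩
    have hlog := ConvAttn.clog_add_one_le_log hn2
    have hd' : (d : ℝ) + 1 ≤ 2 * d := by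
      have : (1 : ℝ) ≤ d := by exact_mod_cast hd
      linarith
    have h0 : 0 ≤ Real.log n := Real.log_natCast_nonneg n
    calc ((ConvAttn.convForward Q K V n 1 0 0).time : ℝ)
        ≤ 1000 * (Nat.clog 2 (2 * n) + 1) * n ^ 2 * (d + 1) := by exact_mod_cast h2
      _ ≤ 1000 * (8 * Real.log n) * n ^ 2 * (2 * d) := by gcongr
      _ = 16000 * (n : ℝ) ^ 2 * d * Real.log n := by ring
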